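/- Let $r\ge 1$ and $n_1,\dots,n_r\ge 1$, and let $P=P_{n_1,\dots,n_r}$ be the complete graded poset of rank $r$: it has exactly $n_i$ elements of rank $i$ for $1\le i\le r$, and $a\prec b$ if and only if the rank of $a$ is less than the rank of $b$. Let $\Delta_{\mathrm{eq}}(P)$ be the equatorial complex of $P$, that is, the simplicial complex whose faces are the (possibly empty) chains $I_1\subset\dots\subset I_t$ of nonempty order ideals of $P$ such that $f=\chi_{I_1}+\dots+\chi_{I_t}$ is equatorial: $\min_{a\in P} f(a)=0$, and for every $2\le j\le r$ there are $a\prec b$ of ranks $j-1$ and $j$ with $f(a)=f(b)$. Let $d=\dim\Delta_{\mathrm{eq}}(P)+1$, let $(h_0,\dots,h_d)$ be the $h$-vector of $\Delta_{\mathrm{eq}}(P)$, and let $$E^{\mathrm{eq}}_P(k)=\sum_{j=0}^{d}h_j\binom{d+k-j}{d}$$ be the equatorial Ehrhart polynomial of $P$, which is a polynomial in $k$. For $m\ge 0$ let $A_m=\mathrm{conv}\{\pm(e_i+\dots+e_j):1\le i\le j\le m\}\subset\mathbb{R}^m$ and let $A_m^\vee=\{x\in\mathbb{R}^m:\langle x,y\rangle\ge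 -1\text{ for all }y\in A_m\}$ be its polar dual (so $A_0^\vee$ is the point $\mathbb{R}^0$). Let $Q=A^\vee_{n_1-1}\oplus\dots\oplus A^\vee_{n_r-1}$ be the free sum, i.e. the convex hull in $\prod_i\mathbb{R}^{n_i-1}$ of the union of the copies of the $A^\vee_{n_i-1}$ in the coordinate subspaces $\mathbb{R}^{n_i-1}$. Then $E^{\mathrm{eq}}_P$ equals the Ehrhart polynomial $E_Q$ of $Q$, that is, $E^{\mathrm{eq}}_P(k)=\#(kQ\cap\mathbb{Z}^{\sum_i(n_i-1)})$ for every integer $k\ge 1$. Consequently $E^{\mathrm{eq}}_P$ is CL (all its complex roots lie on the line $\mathrm{Re}(z)=-\tfrac12$) if and only if $Q$ is a CL-polytope (a reflexive polytope all the complex roots of whose Ehrhart polynomial lie on $\mathrm{Re}(z)=-\tfrac12$). -/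

import Mathlib

open Polynomial
open scoped Pointwise

noncomputable section

/-! ### Lattice polytopes and Ehrhart polynomials -/

/-- The real vector with the given integer coordinates. -/
def intVec {ι : Type*} (v : ι → ℤ) : ι → ℝ := fun i => (v i : ℝ)

/-- The lattice points of the dilate `k Q`. -/
def latticePoints {ι : Type*} (Q : Set (ι → ℝ)) (k : ℕ) : Set (ι → ℤ) :=
  {v | intVec v ∈ (k : ℝ) • Q}

/-- `p` is the Ehrhart polynomial of `Q`: for every positive integer `k` the dilate `k Q`
contains exactly `p(k)` lattice points, finitely many. Such a `p` is unique. -/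
def IsEhrhartPolynomial {ι : Type*} (Q : Set (ι → ℝ)) (p : ℚ[X]) : Prop :=
  ∀ k : ℕ, 1 ≤ k → (latticePoints Q k).Finite ∧ p.eval (k : ℚ) = (latticePoints Q k).ncard

open Classical in
/-- The Ehrhart polynomial `E_Q` (with value `0` if `Q` has none). -/
def ehrhartPolynomial {ι : Type*} (Q : Set (ι → ℝ)) : ℚ[X] :=
  if h : ∃ p : ℚ[X], IsEhrhartPolynomial Q p then h.choose else 0

/-- An integral polytope: the convex hull of finitely many lattice points. -/
def IsIntegralPolytope {ι : Type*} (Q : Set (ι → ℝ)) : Prop :=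
  ∃ S : Finset (ι → ℤ), Q = convexHull ℝ (intVec '' (S : Set (ι → ℤ)))

/-- The polar dual `{x | ⟨x, y⟩ ≥ -1 for all y ∈ Q}`. -/
def polarDual {ι : Type*} [Fintype ι] (Q : Set (ι → ℝ)) : Set (ι → ℝ) :=
  {x | ∀ y ∈ Q, -1 ≤ ∑ i, x i * y i}

/-- Reflexive polytopes. -/
def IsReflexive {ι : Type*} [Fintype ι] (Q : Set (ι → ℝ)) : Prop :=
  IsIntegralPolytope Q ∧ (0 : ι → ℝ) ∈ interior Q ∧ IsIntegralPolytope (polarDual Q)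

/-- All complex roots of `p` lie on the line `Re z = -1/2`. -/
def IsCLPolynomial (p : ℚ[X]) : Prop :=
  ∀ z : ℂ, aeval z p = 0 → z.re = -1 / 2

/-- CL-polytopes: reflexive polytopes all of whose Ehrhart roots lie on `Re z = -1/2`. -/
def IsCLPolytope {ι : Type*} [Fintype ι] (Q : Set (ι → ℝ)) : Prop :=
  IsReflexive Q ∧ IsCLPolynomial (ehrhartPolynomial Q)

/-- The classical root polytope `A_d`, the convex hull of the vectors
`± (e_i + ⋯ + e_j)` with `i ≤ j`. -/
def rootPolytopeA (d : ℕ) : Set (Fin d → ℝ) :=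
  convexHull ℝ {v | ∃ i j : Fin d, i ≤ j ∧
    (v = ∑ k ∈ Finset.Icc i j, Pi.single k (1 : ℝ) ∨
      v = -∑ k ∈ Finset.Icc i j, Pi.single k (1 : ℝ))}

/-- The copy of `Q ⊆ ℝ^(κ i)` in the `i`-th summand of the space `∏ᵢ ℝ^(κ i)`, whose coordinates
are indexed by `Σ i, κ i`: all the other coordinates vanish. -/
def summandCopy {ι : Type*} {κ : ι → Type*} (i : ι) (Q : Set (κ i → ℝ)) :
    Set ((Σ i, κ i) → ℝ) :=
  {x | (∀ j, j ≠ i → ∀ a : κ j, x ⟨j, a⟩ = 0) ∧ (fun a : κ i => x ⟨i, a⟩) ∈ Q}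

/-- The free sum of a family of polytopes (containing their origins): the convex hull of the
union of their copies in the product space. -/
def freeSum {ι : Type*} {κ : ι → Type*} (Q : ∀ i, Set (κ i → ℝ)) : Set ((Σ i, κ i) → ℝ) :=
  convexHull ℝ (⋃ i, summandCopy i (Q i))

/-! ### The h-vector of a finite simplicial complex -/

/-- The number of faces with `i` vertices; the empty face is counted, for `i = 0`. -/
def faceNumber {V : Type*} (K : PreAbstractSimplicialComplex V) (i : ℕ) : ℕ :=
  {s : Finset V | (s = ∅ ∨ s ∈ K.faces) ∧ s.card = i}.ncard

/-- `dim K + 1`: the largest number of vertices of a face (`0` if only the empty face is there). -/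
def complexRank {V : Type*} (K : PreAbstractSimplicialComplex V) : ℕ :=
  sSup (Finset.card '' K.faces)

/-- The h-polynomial `∑ h_j t^j = ∑_i f_{i-1} t^i (1 - t)^(d - i)`, where `d = dim K + 1`. -/
def hPolynomial {V : Type*} (K : PreAbstractSimplicialComplex V) : ℚ[X] :=
  ∑ i ∈ Finset.range (complexRank K + 1),
    (faceNumber K i : ℚ[X]) * X ^ i * (1 - X) ^ (complexRank K - i)

/-- `f^Ehr(δ) = ∑_{j=0}^d δ_j binom(d + k - j, d)` as a polynomial in `k`, where the sequence
`δ = (δ_0, …, δ_d)` is given by the first `d + 1` coefficients of `q`. -/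
def fEhr (d : ℕ) (q : ℚ[X]) : ℚ[X] :=
  ∑ j ∈ Finset.range (d + 1), C (q.coeff j) * preHilbertPoly ℚ d j

/-! ### The equatorial complex of a graded poset -/

section Poset

variable (P : Type*) [PartialOrder P]

/-- The set `P^(i)` of elements of rank `i`; minimal elements have rank `1`. -/
def rankLevel (i : ℕ) : Set P := {a | Order.height a + 1 = (i : ℕ∞)}

/-- The rank of `P`: the largest rank of an element. -/
def posetRank [Fintype P] : ℕ := Finset.univ.sup fun a : P => (Order.height a).toNat + 1

variable {P}

/-- `P`-partitions: nonnegative order-reversing functions. -/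
def IsPPartition (f : P → ℝ) : Prop :=
  (∀ a, 0 ≤ f a) ∧ ∀ a b, a < b → f b ≤ f a

/-- Equatorial `P`-partitions: the minimum is `0`, and between any two consecutive ranks there is
a related pair on which `f` is constant. -/
def IsEquatorial [Fintype P] (f : P → ℝ) : Prop :=
  IsPPartition f ∧ IsLeast (Set.range f) 0 ∧
    ∀ j, 2 ≤ j → j ≤ posetRank P →
      ∃ a ∈ rankLevel P (j - 1), ∃ b ∈ rankLevel P j, a < b ∧ f a = f b

/-- The sum of the characteristic functions of a finite set of order ideals. -/
def charSum (s : Finset (LowerSet P)) : P → ℝ :=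
  fun a => ∑ I ∈ s, Set.indicator (I : Set P) (fun _ => (1 : ℝ)) a

open Classical in
theorem charSum_eq_add {s t : Finset (LowerSet P)} (hts : t ⊆ s) (a : P) :
    charSum s a = charSum (s.filter (· ∉ t)) a + charSum t a := by
  have h : s.filter (· ∉ t) = s \ t := by ext; simp
  rw [h]
  exact (Finset.sum_sdiff hts).symm

theorem isPPartition_charSum (s : Finset (LowerSet P)) : IsPPartition (charSum s) := by
  refine ⟨fun a => Finset.sum_nonneg fun I _ => Set.indicator_nonneg (by simp) a, ?_⟩
  intro a b hab
  refine Finset.sum_le_sum fun I _ => ?_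
  by_cases hb : b ∈ (I : Set P)
  · have ha : a ∈ (I : Set P) := I.lower hab.le hb
    simp [ha, hb]
  · rw [Set.indicator_of_notMem hb]
    exact Set.indicator_nonneg (by simp) a

theorem IsEquatorial.charSum_mono [Fintype P] {s t : Finset (LowerSet P)} (hts : t ⊆ s)
    (h : IsEquatorial (charSum s)) : IsEquatorial (charSum t) := by
  obtain ⟨-, ⟨⟨a, ha⟩, -⟩, h3⟩ := h
  classical
  have h1 := isPPartition_charSum (s.filter (· ∉ t))
  have h2 := isPPartition_charSum t
  refine ⟨h2, ⟨⟨a, ?_⟩, ?_⟩, ?_⟩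
  · have := charSum_eq_add hts a
    have := h1.1 a
    have := h2.1 a
    linarith
  · rintro _ ⟨b, rfl⟩
    exact h2.1 b
  · intro j hj hj'
    obtain ⟨a, ha, b, hb, hab, hf⟩ := h3 j hj hj'
    refine ⟨a, ha, b, hb, hab, ?_⟩
    have := charSum_eq_add hts a
    have := charSum_eq_add hts b
    have := h1.2 a b hab
    have := h2.2 a b hab
    linarith

variable (P)

/-- The equatorial complex: its faces are the equatorial chains `I_1 ⊂ ⋯ ⊂ I_t` of nonempty order
ideals, that is, those for which the sum of the characteristic functions is equatorial. -/
def equatorialComplex [Fintype P] : PreAbstractSimplicialComplex (LowerSet P) where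
  faces := {s | s.Nonempty ∧ (∀ I ∈ s, I ≠ ⊥) ∧
    IsChain (· ≤ ·) (s : Set (LowerSet P)) ∧ IsEquatorial (charSum s)}
  isRelLowerSet_faces := by
    rintro s ⟨hne, hbot, hch, heq⟩
    exact ⟨hne, fun t hts ht => ⟨ht, fun I hI => hbot I (hts hI),
      hch.mono (Finset.coe_subset.2 hts), heq.charSum_mono hts⟩⟩

/-- The equatorial Ehrhart polynomial `f^Ehr(h(Δ_eq(P)))`. -/
def equatorialEhrhartPolynomial [Fintype P] : ℚ[X] :=
  fEhr (complexRank (equatorialComplex P)) (hPolynomial (equatorialComplex P))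

end Poset

/-- The complete graded poset `P_{n_1,…,n_r}`: the elements of rank `i` are the `n_i` pairs
whose first component is the `i`-th element of `Fin r`. -/
def CompleteGradedPoset {r : ℕ} (n : Fin r → ℕ) : Type := Σ i : Fin r, Fin (n i)

instance {r : ℕ} (n : Fin r → ℕ) : Fintype (CompleteGradedPoset n) :=
  inferInstanceAs (Fintype (Σ i : Fin r, Fin (n i)))

/-- Every element of a lower rank is below every element of a higher rank, and there are no
further relations. -/
instance {r : ℕ} (n : Fin r → ℕ) : PartialOrder (CompleteGradedPoset n) where
  le a b := a = b ∨ a.1 < b.1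
  le_refl a := Or.inl rfl
  le_trans a b c hab hbc := by
    rcases hab with rfl | hab
    · exact hbc
    · rcases hbc with rfl | hbc
      · exact Or.inr hab
      · exact Or.inr (hab.trans hbc)
  le_antisymm a b hab hba := by
    rcases hab with rfl | hab
    · rfl
    · rcases hba with rfl | hba
      · rfl
      · exact absurd (hab.trans hba) (lt_irrefl _)

end

open Polynomial
open scoped Pointwise

/-! ### The Ehrhart transform of an h-polynomial -/

/-! Both polynomials count the same finite set. Dividing the h-polynomial by `(1 - X)^(d + 1)` shows
that the equatorial Ehrhart polynomial at `k` is the sum of `binom(k, i)` times the number of faces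
with `i` vertices. A chain of ideals amounts to the function counting the members that contain a
point, so such faces are the equatorial functions with value set `{0, …, i}`
(`faceNumber_equatorialComplex`). Choosing which `i` positive values up to `k` occur yields all
equatorial functions bounded by `k` (`equatorialEhrhartPolynomial_eval`).

On a complete graded poset, being equatorial forces the minimum of each level to equal the maximum
of the next, the last minimum being `0`. Such a function is determined by the consecutive
differences inside its levels, and its maximum is the sum of the oscillations of the levels
(`stack_eq_self`, `bijOn_equatorial`).

On the polytope side, `x` lies in the dual of `A_m` exactly when its partial sums oscillate by at
most `1`. Oscillation is thus the gauge of this dual, and gauges add under free sums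
(`mem_freeSum_iff`). The lattice points of `kQ` are therefore the difference vectors found above.

Reflexivity holds for every choice of level sizes: the dual of `A_m` is a projected cube, and the
dual of the free sum is a product of biduals, computed by the bipolar theorem. So the CL condition
concerns the roots alone. -/

theorem preHilbertPoly_self_eval (i k : ℕ) :
    (preHilbertPoly ℚ i i).eval (k : ℚ) = k.choose i := by
  rcases le_or_gt i k with h | h
  · rw [preHilbertPoly_eq_choose_sub_add ℚ i h, Nat.sub_add_cancel h]
  -- For `k < i` the rising factorial starts at a nonpositive integer and runs through `0`.
  · have e : (k : ℚ) - i + 1 = -((i - 1 - k : ℕ) : ℚ) := by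
      rw [Nat.sub_sub, Nat.cast_sub (by omega)]
      push_cast
      ring
    have h' : i - 1 - k < i := by omega
    simp [preHilbertPoly, Nat.choose_eq_zero_of_lt h, e, ascPochhammer_eval_neg_coe_nat_of_lt h']

/-- The degree bound means that truncating to `d + 1` coefficients loses nothing; `hilbertPoly` then
supplies linearity and cancellation of factors `1 - X`. -/
theorem fEhr_eq_hilbertPoly {d : ℕ} {q : ℚ[X]} (h : q.natDegree ≤ d) :
    fEhr d q = hilbertPoly q (d + 1) := by
  rw [hilbertPoly_succ, fEhr]
  symm
  rw [Finset.sum_subset (s₂ := Finset.range (d + 1))]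
  · simp [smul_eq_C_mul]
  · intro i hi
    have := le_natDegree_of_mem_supp i hi
    simp only [Finset.mem_range]
    omega
  · intro i _ hi
    simp [notMem_support_iff.1 hi]

theorem natDegree_natCast_mul_X_pow_mul_le {d i : ℕ} (h : i ≤ d) (a : ℕ) :
    ((a : ℚ[X]) * X ^ i * (1 - X) ^ (d - i)).natDegree ≤ d := by
  have h1 : ((1 : ℚ[X]) - X).natDegree ≤ 1 := by
    refine (natDegree_sub_le _ _).trans ?_
    simp
  have h2 : (((1 : ℚ[X]) - X) ^ (d - i)).natDegree ≤ d - i :=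
    natDegree_pow_le.trans (by simpa using Nat.mul_le_mul_left (d - i) h1)
  have h3 : ((a : ℚ[X]) * X ^ i).natDegree ≤ i := by
    refine natDegree_mul_le.trans ?_
    simp
  refine natDegree_mul_le.trans ?_
  omega

/-- After division by `(1 - X)^(d + 1)` the `i`-th summand becomes a multiple of `X^i / (1 - X)^(i +
1)`, the generating function of `binom(k, i)`. -/
theorem fEhr_hPolynomial_eval {V : Type*} (K : PreAbstractSimplicialComplex V) (k : ℕ) :
    (fEhr (complexRank K) (hPolynomial K)).eval (k : ℚ) =
      ∑ i ∈ Finset.range (complexRank K + 1), (faceNumber K i : ℚ) * k.choose i := by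
  have hle : ∀ i ∈ Finset.range (complexRank K + 1), i ≤ complexRank K := fun i hi => by
    simpa [Nat.lt_succ_iff] using hi
  rw [fEhr_eq_hilbertPoly]
  · have : hilbertPoly (hPolynomial K) (complexRank K + 1) =
        ∑ i ∈ Finset.range (complexRank K + 1),
          (faceNumber K i : ℚ) • preHilbertPoly ℚ i i := by
      rw [hPolynomial]
      refine (map_sum (hilbertPoly_linearMap ℚ (complexRank K + 1)) _ _).trans ?_
      refine Finset.sum_congr rfl fun i hi => ?_
      refine Eq.trans (b := hilbertPoly _ (complexRank K + 1)) rfl ?_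
      have e : complexRank K + 1 = (i + 1) + (complexRank K - i) := by
        have := hle i hi
        omega
      rw [e, hilbertPoly_mul_one_sub_pow_add, ← hilbertPoly_X_pow_succ, ← hilbertPoly_smul,
        smul_eq_C_mul]
      simp
    simp [this, eval_finsetSum, preHilbertPoly_self_eval]
  · exact natDegree_sum_le_of_forall_le _ _ fun i hi =>
      natDegree_natCast_mul_X_pow_mul_le (hle i hi) _

theorem faceNumber_eq_zero {V : Type*} [Finite V] (K : PreAbstractSimplicialComplex V) {i : ℕ}
    (h : complexRank K < i) : faceNumber K i = 0 := by
  have hfin : (Finset.card '' K.faces).Finite := Set.toFinite _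
  rw [faceNumber, Set.ncard_eq_zero]
  refine Set.eq_empty_of_forall_notMem ?_
  rintro s ⟨rfl | hs, hi⟩
  · simp at hi
    omega
  · have : s.card ≤ complexRank K := le_csSup hfin.bddAbove ⟨s, hs, rfl⟩
    omega

theorem fEhr_hPolynomial_eval_eq_sum_range {V : Type*} [Finite V]
    (K : PreAbstractSimplicialComplex V) (k : ℕ) :
    (fEhr (complexRank K) (hPolynomial K)).eval (k : ℚ) =
      ∑ i ∈ Finset.range (k + 1), (k.choose i : ℚ) * faceNumber K i := by
  rw [fEhr_hPolynomial_eval]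
  have h1 : Finset.range (complexRank K + 1) ⊆ Finset.range (max (complexRank K) k + 1) :=
    Finset.range_subset_range.2 (by omega)
  have h2 : Finset.range (k + 1) ⊆ Finset.range (max (complexRank K) k + 1) :=
    Finset.range_subset_range.2 (by omega)
  rw [Finset.sum_subset h1, Finset.sum_subset h2]
  · exact Finset.sum_congr rfl fun i _ => mul_comm _ _
  · intro i _ hi
    rw [Nat.choose_eq_zero_of_lt (by simp at hi; omega)]
    simp
  · intro i _ hi
    rw [faceNumber_eq_zero K (by simp at hi; omega)]
    simp

/-! ### Faces of the equatorial complex as surjective equatorial functions -/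

section Poset

variable {P : Type*} [PartialOrder P]

open Classical in
/-- The number of members of `s` that contain the given element. -/
noncomputable def idealCount (s : Finset (LowerSet P)) (a : P) : ℕ := (s.filter (a ∈ ·)).card

theorem charSum_eq_idealCount (s : Finset (LowerSet P)) :
    charSum s = fun a => (idealCount s a : ℝ) := by
  funext a
  rw [charSum, idealCount, Finset.card_filter]
  push_cast
  refine Finset.sum_congr rfl fun I _ => ?_
  by_cases h : a ∈ I <;> simp [h]

/-- The order ideal on which an antitone function is at least `t`. -/
def superlevel (c : P → ℕ) (t : ℕ) : LowerSet P := lowerClosure {a | t ≤ c a}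

theorem mem_superlevel {c : P → ℕ} (hc : Antitone c) {t : ℕ} {a : P} :
    a ∈ superlevel c t ↔ t ≤ c a :=
  ⟨fun ⟨_, hb, hab⟩ => le_trans hb (hc hab), fun h => ⟨a, h, le_rfl⟩⟩

theorem superlevel_antitone (c : P → ℕ) : Antitone (superlevel c) := fun _ _ h =>
  lowerClosure_mono fun _ ha => le_trans h ha

theorem IsPPartition.antitone {c : P → ℕ} (h : IsPPartition fun a => (c a : ℝ)) :
    Antitone c := fun a b hab => by
  rcases hab.eq_or_lt with rfl | hab
  · exact le_rfl
  · exact Nat.cast_le.1 (h.2 a b hab)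

theorem antitone_idealCount (s : Finset (LowerSet P)) : Antitone (idealCount s) := by
  have := isPPartition_charSum s
  rw [charSum_eq_idealCount] at this
  exact this.antitone

/-- The threshold for `I` is the number of members containing `I`: in a chain, a point outside `I`
lies only in members strictly larger than `I`, hence in fewer of them. -/
theorem superlevel_idealCount {s : Finset (LowerSet P)}
    (hs : IsChain (· ≤ ·) (s : Set (LowerSet P))) {I : LowerSet P} (hI : I ∈ s) :
    ∃ t ∈ Finset.Icc 1 s.card, superlevel (idealCount s) t = I := by
  classical
  refine ⟨(s.filter (I ≤ ·)).card, ?_, ?_⟩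
  · refine Finset.mem_Icc.2 ⟨Finset.card_pos.2 ⟨I, by simp [hI]⟩, Finset.card_filter_le _ _⟩
  · ext a
    rw [SetLike.mem_coe, SetLike.mem_coe, mem_superlevel (antitone_idealCount s)]
    constructor
    · intro h
      by_contra ha
      refine absurd h (not_le.2 (Finset.card_lt_card ?_))
      refine (Finset.ssubset_iff_of_subset fun J hJ => ?_).2 ⟨I, by simp [hI], by simp [ha]⟩
      simp only [Finset.mem_filter] at hJ ⊢
      refine ⟨hJ.1, (hs.total hI hJ.1).resolve_right fun h' => ha (h' hJ.2)⟩
    · intro ha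
      refine Finset.card_le_card fun J hJ => ?_
      simp only [Finset.mem_filter] at hJ ⊢
      exact ⟨hJ.1, hJ.2 ha⟩

open Classical in
theorem eq_image_superlevel {s : Finset (LowerSet P)}
    (hs : IsChain (· ≤ ·) (s : Set (LowerSet P))) :
    (Finset.Icc 1 s.card).image (superlevel (idealCount s)) = s := by
  symm
  apply Finset.eq_of_subset_of_card_le
  · intro I hI
    simpa using superlevel_idealCount hs hI
  · exact Finset.card_image_le.trans (by simp)

theorem range_idealCount {s : Finset (LowerSet P)}
    (hs : IsChain (· ≤ ·) (s : Set (LowerSet P))) (hbot : ∀ I ∈ s, I ≠ ⊥)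
    (h0 : ∃ a, idealCount s a = 0) : Set.range (idealCount s) = Set.Iic s.card := by
  classical
  have him := eq_image_superlevel hs
  have hinj : Set.InjOn (superlevel (idealCount s)) (Finset.Icc 1 s.card) := by
    rw [← Finset.card_image_iff, him, Nat.card_Icc, Nat.add_sub_cancel]
  ext t
  constructor
  · rintro ⟨a, rfl⟩
    exact Finset.card_filter_le _ _
  · intro ht
    have ht' : t ≤ s.card := ht
    by_contra hne
    have hne' : ∀ a, idealCount s a ≠ t := fun a ha => hne ⟨a, ha⟩
    rcases Nat.eq_zero_or_pos t with rfl | hpos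
    · obtain ⟨a, ha⟩ := h0
      exact hne' a ha
    -- A skipped value makes two consecutive superlevel sets coincide. This contradicts injectivity,
    -- or, at the top value, makes a member of the chain empty.
    have key : superlevel (idealCount s) t = superlevel (idealCount s) (t + 1) := by
      ext a
      rw [SetLike.mem_coe, SetLike.mem_coe, mem_superlevel (antitone_idealCount s),
        mem_superlevel (antitone_idealCount s)]
      have := hne' a
      omega
    rcases ht'.eq_or_lt with h | h
    · have hmem : superlevel (idealCount s) t ∈ s := by
        refine him.subset ?_
        exact Finset.mem_image.2 ⟨t, Finset.mem_Icc.2 ⟨hpos, ht'⟩, rfl⟩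
      refine hbot _ hmem ?_
      rw [key, eq_bot_iff]
      intro a ha
      rw [SetLike.mem_coe, mem_superlevel (antitone_idealCount s)] at ha
      have : idealCount s a ≤ s.card := Finset.card_filter_le _ _
      omega
    · have := hinj (by simp; omega) (by simp; omega) key
      omega

open Classical in
/-- The chain of nonempty superlevel sets of a function with values `0, …, i`. -/
noncomputable def superlevelChain (c : P → ℕ) (i : ℕ) : Finset (LowerSet P) :=
  (Finset.Icc 1 i).image (superlevel c)

theorem injOn_superlevel {c : P → ℕ} (hc : Antitone c) {i : ℕ} (hr : Set.range c = Set.Iic i) :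
    Set.InjOn (superlevel c) (Finset.Icc 1 i) := by
  have key : ∀ t ∈ Finset.Icc 1 i, ∀ u, superlevel c t = superlevel c u → u ≤ t := by
    intro t ht u h
    have : t ∈ Set.range c := hr ▸ (Finset.mem_Icc.1 ht).2
    obtain ⟨a, rfl⟩ := this
    rw [← mem_superlevel hc, ← h, mem_superlevel hc]
  intro t ht u hu h
  exact le_antisymm (key u hu t h.symm) (key t ht u h)

theorem card_superlevelChain {c : P → ℕ} (hc : Antitone c) {i : ℕ}
    (hr : Set.range c = Set.Iic i) : (superlevelChain c i).card = i := by
  classical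
  rw [superlevelChain, Finset.card_image_of_injOn (injOn_superlevel hc hr)]
  simp

theorem idealCount_superlevelChain {c : P → ℕ} (hc : Antitone c) {i : ℕ}
    (hr : Set.range c = Set.Iic i) : idealCount (superlevelChain c i) = c := by
  classical
  funext a
  have ha : c a ≤ i := by
    have : c a ∈ Set.Iic i := hr ▸ Set.mem_range_self a
    exact this
  rw [idealCount, superlevelChain, Finset.filter_image, Finset.card_image_of_injOn]
  · have : (Finset.Icc 1 i).filter (fun t => a ∈ superlevel c t) = Finset.Icc 1 (c a) := by
      ext t
      simp only [Finset.mem_filter, Finset.mem_Icc, mem_superlevel hc]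
      omega
    simp [this]
  · exact (injOn_superlevel hc hr).mono fun t ht => (Finset.mem_filter.1 ht).1

variable [Fintype P]

theorem IsEquatorial.exists_eq_zero {c : P → ℕ} (h : IsEquatorial fun a => (c a : ℝ)) :
    ∃ a, c a = 0 := by
  obtain ⟨a, ha⟩ := h.2.1.1
  exact ⟨a, Nat.cast_eq_zero.1 ha⟩

/-- `idealCount` and `superlevelChain` are mutually inverse here. The hypothesis `h0` takes care of
the empty face, which corresponds to the zero function. -/
theorem faceNumber_equatorialComplex (h0 : IsEquatorial (0 : P → ℝ)) (i : ℕ) :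
    faceNumber (equatorialComplex P) i =
      {c : P → ℕ | IsEquatorial (fun a => (c a : ℝ)) ∧ Set.range c = Set.Iic i}.ncard := by
  have hface : ∀ s : Finset (LowerSet P), (s = ∅ ∨ s ∈ (equatorialComplex P).faces) ↔
      (∀ I ∈ s, I ≠ ⊥) ∧ IsChain (· ≤ ·) (s : Set (LowerSet P)) ∧
        IsEquatorial (fun a => (idealCount s a : ℝ)) := by
    intro s
    rw [← charSum_eq_idealCount]
    rcases s.eq_empty_or_nonempty with rfl | hs
    · have : charSum (∅ : Finset (LowerSet P)) = 0 := by
        funext a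
        simp [charSum]
      simp [this, h0]
    · simp [equatorialComplex, hs, hs.ne_empty]
  rw [faceNumber]
  refine Set.ncard_congr (fun s _ => idealCount s) ?_ ?_ ?_
  · rintro s ⟨hs, rfl⟩
    obtain ⟨h1, h2, h3⟩ := (hface s).1 hs
    exact ⟨h3, range_idealCount h2 h1 h3.exists_eq_zero⟩
  · rintro s s' ⟨hs, rfl⟩ ⟨hs', h⟩ he
    have e := eq_image_superlevel ((hface s).1 hs).2.1
    rw [← h] at e
    change idealCount s = idealCount s' at he
    rw [he, eq_image_superlevel ((hface s').1 hs').2.1] at e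
    exact e.symm
  · rintro c ⟨hc, hr⟩
    have ha := hc.1.antitone
    refine ⟨superlevelChain c i, ⟨(hface _).2 ⟨?_, ?_, ?_⟩, card_superlevelChain ha hr⟩,
      idealCount_superlevelChain ha hr⟩
    · intro I hI
      simp only [superlevelChain, Finset.mem_image, Finset.mem_Icc] at hI
      obtain ⟨t, ht, rfl⟩ := hI
      have : t ∈ Set.range c := hr ▸ ht.2
      obtain ⟨a, rfl⟩ := this
      intro hb
      have : a ∈ superlevel c (c a) := (mem_superlevel ha).2 le_rfl
      rw [hb] at this
      simp at this
    · rintro _ hI _ hJ _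
      simp only [superlevelChain, Finset.coe_image, Set.mem_image] at hI hJ
      obtain ⟨t, -, rfl⟩ := hI
      obtain ⟨u, -, rfl⟩ := hJ
      rcases le_total t u with h | h
      · exact Or.inr (superlevel_antitone c h)
      · exact Or.inl (superlevel_antitone c h)
    · rwa [idealCount_superlevelChain ha hr]

/-! ### Counting bounded equatorial functions by their sets of values -/

/-- The condition sees only the order pattern of the values and where they vanish, so positive
values may be relabelled increasingly. -/
theorem IsEquatorial.congr_order {f c : P → ℕ} (h : ∀ a b, f a ≤ f b ↔ c a ≤ c b)
    (hz : ∀ a, f a = 0 ↔ c a = 0) (hf : IsEquatorial fun a => (f a : ℝ)) :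
    IsEquatorial fun a => (c a : ℝ) := by
  obtain ⟨a, ha⟩ := hf.exists_eq_zero
  refine ⟨⟨fun a => Nat.cast_nonneg _, fun a b hab => ?_⟩, ⟨⟨a, ?_⟩, ?_⟩, ?_⟩
  · exact Nat.cast_le.2 ((h b a).1 (hf.1.antitone hab.le))
  · exact Nat.cast_eq_zero.2 ((hz a).1 ha)
  · rintro _ ⟨b, rfl⟩
    exact Nat.cast_nonneg _
  · intro j hj hj'
    obtain ⟨a, ha, b, hb, hab, he⟩ := hf.2.2 j hj hj'
    have he' : f a = f b := Nat.cast_injective he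
    refine ⟨a, ha, b, hb, hab, ?_⟩
    exact congrArg _ (le_antisymm ((h a b).1 he'.le) ((h b a).1 he'.ge))

theorem ncard_equatorial_range_eq (V : Finset ℕ) (hV : 0 ∉ V) :
    {f : P → ℕ | IsEquatorial (fun a => (f a : ℝ)) ∧ Set.range f = insert 0 (V : Set ℕ)}.ncard =
      {c : P → ℕ | IsEquatorial (fun a => (c a : ℝ)) ∧ Set.range c = Set.Iic V.card}.ncard := by
  classical
  -- `Nat.count p` and `Nat.nth p` are the increasing bijections between `V ∪ {0}` and `{0, …,
  -- |V|}`; both fix `0`.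
  set p : ℕ → Prop := fun x => x ∈ insert 0 V with hp
  have hfin : (Set.ofPred p).Finite := (insert 0 V).finite_toSet
  have hcard : hfin.toFinset.card = V.card + 1 := by
    rw [← Finset.card_insert_of_notMem hV]
    congr 1
    ext x
    simp [hp]
  have p0 : p 0 := by simp [hp]
  have hnth0 : Nat.nth p 0 = 0 := by simpa using Nat.nth_count p0
  have hcount_lt : ∀ x, p x → Nat.count p x ≤ V.card := fun x hx => by
    have := Nat.count_lt_card hfin hx
    omega
  have hnth_mem : ∀ t ≤ V.card, p (Nat.nth p t) := fun t ht =>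
    Nat.nth_mem_of_lt_card hfin (by omega)
  have hcn : ∀ t ≤ V.card, Nat.count p (Nat.nth p t) = t := fun t ht =>
    Nat.count_nth_of_lt_card_finite hfin (by omega)
  have hnc : ∀ x, p x → Nat.nth p (Nat.count p x) = x := fun x hx => Nat.nth_count hx
  have hle : ∀ x y, p x → p y → (x ≤ y ↔ Nat.count p x ≤ Nat.count p y) := fun x y hx hy =>
    ⟨fun h => Nat.count_monotone p h, fun h => by
      by_contra hlt
      exact absurd (Nat.count_strict_mono hy (not_le.1 hlt)) (not_lt.2 h)⟩
  refine Set.ncard_congr (fun f _ => fun a => Nat.count p (f a)) ?_ ?_ ?_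
  · rintro f ⟨hf, hr⟩
    have hfp : ∀ a, p (f a) := fun a => by
      have : f a ∈ insert 0 (V : Set ℕ) := hr ▸ Set.mem_range_self a
      simpa [hp] using this
    refine ⟨hf.congr_order (fun a b => hle _ _ (hfp a) (hfp b)) fun a => ?_, ?_⟩
    · refine ⟨fun h => by simp [h], fun h => ?_⟩
      rw [← hnc _ (hfp a), h, hnth0]
    · ext t
      constructor
      · rintro ⟨a, rfl⟩
        exact hcount_lt _ (hfp a)
      · intro ht
        have : Nat.nth p t ∈ Set.range f := by
          rw [hr]
          simpa [hp] using hnth_mem t ht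
        obtain ⟨a, ha⟩ := this
        exact ⟨a, by simp only [ha, hcn t ht]⟩
  · rintro f g ⟨-, hf⟩ ⟨-, hg⟩ h
    funext a
    have h1 : f a ∈ insert 0 (V : Set ℕ) := hf ▸ Set.mem_range_self a
    have h2 : g a ∈ insert 0 (V : Set ℕ) := hg ▸ Set.mem_range_self a
    exact Nat.count_injective (p := p) (by simpa [hp] using h1) (by simpa [hp] using h2)
      (congrFun h a)
  · rintro c ⟨hc, hr⟩
    have hcV : ∀ a, c a ≤ V.card := fun a => by
      have : c a ∈ Set.Iic V.card := hr ▸ Set.mem_range_self a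
      exact this
    refine ⟨fun a => Nat.nth p (c a), ⟨hc.congr_order (fun a b => ?_) fun a => ?_, ?_⟩, ?_⟩
    · rw [hle _ _ (hnth_mem _ (hcV a)) (hnth_mem _ (hcV b)), hcn _ (hcV a), hcn _ (hcV b)]
    · refine ⟨fun h => by simp [h, hnth0], fun h => ?_⟩
      rw [← hcn _ (hcV a), h]
      simp
    · ext x
      constructor
      · rintro ⟨a, rfl⟩
        simpa [hp] using hnth_mem _ (hcV a)
      · intro hx
        have hx' : p x := by simpa [hp] using hx
        have : Nat.count p x ∈ Set.range c := hr ▸ hcount_lt x hx'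
        obtain ⟨a, ha⟩ := this
        exact ⟨a, by simp only [ha, hnc x hx']⟩
    · funext a
      exact hcn _ (hcV a)

/-- The functions are sorted by their set `V` of positive values; each fibre depends only on the
size of `V`. -/
theorem ncard_equatorial_le (k : ℕ) :
    {f : P → ℕ | IsEquatorial (fun a => (f a : ℝ)) ∧ ∀ a, f a ≤ k}.ncard =
      ∑ i ∈ Finset.range (k + 1), k.choose i *
        {c : P → ℕ | IsEquatorial (fun a => (c a : ℝ)) ∧ Set.range c = Set.Iic i}.ncard := by
  classical
  have hfin : {f : P → ℕ | IsEquatorial (fun a => (f a : ℝ)) ∧ ∀ a, f a ≤ k}.Finite :=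
    (Set.Finite.pi' fun _ => Set.finite_Iic k).subset fun f hf => hf.2
  have hmaps : ∀ f ∈ hfin.toFinset,
      (Finset.univ.image f).erase 0 ∈ (Finset.Icc 1 k).powerset := by
    intro f hf
    obtain ⟨-, hf⟩ := hfin.mem_toFinset.1 hf
    refine Finset.mem_powerset.2 fun x hx => ?_
    simp only [Finset.mem_erase, Finset.mem_image, Finset.mem_univ, true_and] at hx
    obtain ⟨hx0, a, rfl⟩ := hx
    exact Finset.mem_Icc.2 ⟨Nat.pos_of_ne_zero hx0, hf a⟩
  rw [Set.ncard_eq_toFinset_card _ hfin, Finset.card_eq_sum_card_fiberwise hmaps]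
  have := Finset.sum_powerset_apply_card (x := Finset.Icc 1 k) fun i =>
    {c : P → ℕ | IsEquatorial (fun a => (c a : ℝ)) ∧ Set.range c = Set.Iic i}.ncard
  simp only [Nat.card_Icc, Nat.add_sub_cancel, smul_eq_mul] at this
  rw [← this]
  refine Finset.sum_congr rfl fun V hV => ?_
  have hV' : ∀ x ∈ V, 1 ≤ x ∧ x ≤ k := fun x hx =>
    Finset.mem_Icc.1 (Finset.mem_powerset.1 hV hx)
  have hV0 : 0 ∉ V := fun h => by
    have := (hV' 0 h).1
    omega
  rw [← ncard_equatorial_range_eq V hV0, ← Set.ncard_coe_finset]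
  congr 1
  ext f
  simp only [Finset.coe_filter, Set.Finite.mem_toFinset, Set.mem_ofPred_eq]
  constructor
  · rintro ⟨⟨hf, -⟩, rfl⟩
    refine ⟨hf, ?_⟩
    obtain ⟨a, ha⟩ := hf.exists_eq_zero
    ext x
    rcases eq_or_ne x 0 with rfl | hx
    · simpa using ⟨a, ha⟩
    · simp [hx]
  · rintro ⟨hf, hr⟩
    refine ⟨⟨hf, fun a => ?_⟩, ?_⟩
    · have : f a ∈ insert 0 (V : Set ℕ) := hr ▸ Set.mem_range_self a
      rcases this with h | h
      · omega
      · exact (hV' _ h).2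
    · have : Finset.univ.image f = insert 0 V := by
        ext x
        have := Set.ext_iff.1 hr x
        simpa using this
      rw [this, Finset.erase_insert hV0]

theorem equatorialEhrhartPolynomial_eval (h0 : IsEquatorial (0 : P → ℝ)) (k : ℕ) :
    (equatorialEhrhartPolynomial P).eval (k : ℚ) =
      {f : P → ℕ | IsEquatorial (fun a => (f a : ℝ)) ∧ ∀ a, f a ≤ k}.ncard := by
  have : Finite (LowerSet P) := Finite.of_injective _ (SetLike.coe_injective (A := LowerSet P))
  rw [equatorialEhrhartPolynomial, fEhr_hPolynomial_eval_eq_sum_range, ncard_equatorial_le]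
  push_cast
  simp only [faceNumber_equatorialComplex h0]

end Poset

/-! ### Equatorial functions on a complete graded poset -/

namespace CompleteGradedPoset

theorem lt_iff {r : ℕ} {n : Fin r → ℕ} {x y : CompleteGradedPoset n} : x < y ↔ x.1 < y.1 := by
  rw [lt_iff_le_and_ne]
  constructor
  · rintro ⟨rfl | h, hne⟩
    · exact absurd rfl hne
    · exact h
  · refine fun h => ⟨Or.inr h, ?_⟩
    rintro rfl
    exact lt_irrefl _ h

/-- Level sizes of the form `m i + 1` make every level nonempty, so a chain below `x` can visit each
lower level. -/
theorem height_eq {r : ℕ} {m : Fin r → ℕ} (x : CompleteGradedPoset fun i => m i + 1) :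
    Order.height x = (x.1.val : ℕ∞) := by
  apply le_antisymm
  · have hf : StrictMono fun y : CompleteGradedPoset (fun i => m i + 1) => y.1.val :=
      fun y z h => lt_iff.1 h
    have := Order.height_le_height_apply_of_strictMono _ hf x
    simpa using this
  · have key : ∀ k : ℕ, ∀ y : CompleteGradedPoset (fun i => m i + 1), y.1.val = k →
        (k : ℕ∞) ≤ Order.height y := by
      intro k
      induction k with
      | zero => simp
      | succ k ih =>
        intro y hy
        have hk : k < r := by
          have := y.1.isLt
          omega
        let z : CompleteGradedPoset (fun i => m i + 1) := ⟨⟨k, hk⟩, 0⟩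
        have hz : z < y := lt_iff.2 (Fin.lt_def.2 (by simp [z]; omega))
        push_cast
        exact (add_le_add_left (ih z rfl) 1).trans (Order.height_add_one_le hz)
    exact key _ x rfl

variable {r : ℕ} {m : Fin r → ℕ}

theorem mem_rankLevel {x : CompleteGradedPoset fun i => m i + 1} {j : ℕ} :
    x ∈ rankLevel (CompleteGradedPoset fun i => m i + 1) j ↔ x.1.val + 1 = j := by
  change Order.height x + 1 = (j : ℕ∞) ↔ _
  rw [height_eq]
  norm_cast

theorem posetRank_eq : posetRank (CompleteGradedPoset fun i => m i + 1) = r := by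
  apply le_antisymm
  · refine Finset.sup_le fun x _ => ?_
    rw [height_eq]
    exact x.1.isLt
  · rcases Nat.eq_zero_or_pos r with h | h
    · omega
    · let z : CompleteGradedPoset (fun i => m i + 1) := ⟨⟨r - 1, by omega⟩, 0⟩
      have := Finset.le_sup (f := fun a : CompleteGradedPoset (fun i => m i + 1) =>
        (Order.height a).toNat + 1) (Finset.mem_univ z)
      rw [height_eq, ENat.toNat_natCast] at this
      exact (show r ≤ r - 1 + 1 by omega).trans this

theorem isEquatorial_iff {f : CompleteGradedPoset (fun i => m i + 1) → ℝ} :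
    IsEquatorial f ↔ (∀ x, 0 ≤ f x) ∧ (∀ i j, i < j → ∀ a b, f ⟨j, b⟩ ≤ f ⟨i, a⟩) ∧
      (∃ x, f x = 0) ∧ ∀ i j : Fin r, i.val + 1 = j.val → ∃ a b, f ⟨i, a⟩ = f ⟨j, b⟩ := by
  constructor
  · rintro ⟨⟨h0, h1⟩, ⟨h2, -⟩, h3⟩
    refine ⟨h0, fun i j hij a b => h1 _ _ (lt_iff.2 hij), h2, fun i j hij => ?_⟩
    obtain ⟨⟨i', a⟩, ha, ⟨j', b⟩, hb, -, he⟩ := h3 (j.val + 1) (by omega)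
      (by rw [posetRank_eq]; exact j.isLt)
    have hi' : i' = i := by
      have := mem_rankLevel.1 ha
      ext
      simp only at this
      omega
    have hj' : j' = j := by
      have := mem_rankLevel.1 hb
      ext
      simp only at this
      omega
    subst hi' hj'
    exact ⟨a, b, he⟩
  · rintro ⟨h0, h1, h2, h3⟩
    refine ⟨⟨h0, fun x y hxy => h1 _ _ (lt_iff.1 hxy) _ _⟩, ⟨h2, ?_⟩, fun j hj hj' => ?_⟩
    · rintro _ ⟨x, rfl⟩
      exact h0 x
    · rw [posetRank_eq] at hj'
      -- Ranks start at `1` and indices at `0`, so the ranks `j - 1` and `j` have indices `j - 2`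
      -- and `j - 1`.
      obtain ⟨a, b, he⟩ := h3 ⟨j - 2, by omega⟩ ⟨j - 1, by omega⟩ (by simp only; omega)
      refine ⟨⟨_, a⟩, mem_rankLevel.2 ?_, ⟨_, b⟩, mem_rankLevel.2 ?_, lt_iff.2 ?_, he⟩
      · simp only
        omega
      · simp only
        omega
      · rw [Fin.lt_def]
        simp only
        omega

theorem isEquatorial_zero (hr : 1 ≤ r) :
    IsEquatorial (0 : CompleteGradedPoset (fun i => m i + 1) → ℝ) :=
  isEquatorial_iff.2 ⟨fun _ => le_rfl, fun _ _ _ _ _ => le_rfl, ⟨⟨⟨0, hr⟩, 0⟩, rfl⟩,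
    fun _ _ _ => ⟨0, 0, rfl⟩⟩

end CompleteGradedPoset

/-! ### Oscillation of functions on the levels -/

section Levels

variable {r : ℕ} {m : Fin r → ℕ}

/-- The height of `g i a` above the minimum of `g` on the level `i`. -/
def levelRise (g : ∀ i, Fin (m i + 1) → ℤ) (i : Fin r) (a : Fin (m i + 1)) : ℤ :=
  Finset.univ.sup' Finset.univ_nonempty fun b => g i a - g i b

/-- The oscillation of `g` on the level `i`. -/
def levelOsc (g : ∀ i, Fin (m i + 1) → ℤ) (i : Fin r) : ℤ :=
  Finset.univ.sup' Finset.univ_nonempty (levelRise g i)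

/-- The levels of `g`, translated so that they stack into an equatorial function. -/
def stack (g : ∀ i, Fin (m i + 1) → ℤ) (i : Fin r) (a : Fin (m i + 1)) : ℤ :=
  levelRise g i a + ∑ j ∈ Finset.Ioi i, levelOsc g j

variable (g : ∀ i, Fin (m i + 1) → ℤ)

theorem sub_le_levelRise (i : Fin r) (a b : Fin (m i + 1)) : g i a - g i b ≤ levelRise g i a :=
  Finset.le_sup' (fun b => g i a - g i b) (Finset.mem_univ b)

theorem levelRise_nonneg (i : Fin r) (a : Fin (m i + 1)) : 0 ≤ levelRise g i a := by
  simpa using sub_le_levelRise g i a a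

theorem levelRise_le_levelOsc (i : Fin r) (a : Fin (m i + 1)) : levelRise g i a ≤ levelOsc g i :=
  Finset.le_sup' (levelRise g i) (Finset.mem_univ a)

theorem levelOsc_nonneg (i : Fin r) : 0 ≤ levelOsc g i :=
  (levelRise_nonneg g i 0).trans (levelRise_le_levelOsc g i 0)

theorem sub_le_levelOsc (i : Fin r) (a b : Fin (m i + 1)) : g i a - g i b ≤ levelOsc g i :=
  (sub_le_levelRise g i a b).trans (levelRise_le_levelOsc g i a)

theorem exists_levelRise_eq_levelOsc (i : Fin r) : ∃ a, levelRise g i a = levelOsc g i := by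
  obtain ⟨a, -, ha⟩ := Finset.exists_mem_eq_sup' Finset.univ_nonempty (levelRise g i)
  exact ⟨a, ha.symm⟩

theorem exists_sub_eq_levelOsc (i : Fin r) : ∃ a b, g i a - g i b = levelOsc g i := by
  obtain ⟨a, ha⟩ := exists_levelRise_eq_levelOsc g i
  obtain ⟨b, -, hb⟩ := Finset.exists_mem_eq_sup' Finset.univ_nonempty fun b => g i a - g i b
  exact ⟨a, b, hb.symm.trans ha⟩

variable {g}

theorem levelRise_eq_sub {i : Fin r} {a₀ : Fin (m i + 1)} (h : ∀ b, g i a₀ ≤ g i b)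
    (a : Fin (m i + 1)) : levelRise g i a = g i a - g i a₀ :=
  le_antisymm (Finset.sup'_le _ _ fun b _ => by have := h b; omega) (sub_le_levelRise g i a a₀)

theorem exists_levelRise_eq_zero (g : ∀ i, Fin (m i + 1) → ℤ) (i : Fin r) :
    ∃ a, levelRise g i a = 0 := by
  obtain ⟨a, -, ha⟩ := Finset.exists_min_image Finset.univ (g i) Finset.univ_nonempty
  exact ⟨a, by rw [levelRise_eq_sub fun b => ha b (Finset.mem_univ b), sub_self]⟩

theorem levelRise_congr {g' : ∀ i, Fin (m i + 1) → ℤ}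
    (h : ∀ i a b, g i a - g i b = g' i a - g' i b) : levelRise g = levelRise g' := by
  funext i a
  simp only [levelRise, h]

theorem levelOsc_congr {g' : ∀ i, Fin (m i + 1) → ℤ}
    (h : ∀ i a b, g i a - g i b = g' i a - g' i b) : levelOsc g = levelOsc g' := by
  funext i
  simp only [levelOsc, levelRise_congr h]

theorem stack_congr {g' : ∀ i, Fin (m i + 1) → ℤ}
    (h : ∀ i a b, g i a - g i b = g' i a - g' i b) : stack g = stack g' := by
  funext i a
  simp only [stack, levelRise_congr h, levelOsc_congr h]

theorem stack_sub_stack (g : ∀ i, Fin (m i + 1) → ℤ) (i : Fin r) (a b : Fin (m i + 1)) :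
    stack g i a - stack g i b = g i a - g i b := by
  obtain ⟨a₀, -, ha⟩ := Finset.exists_min_image Finset.univ (g i) Finset.univ_nonempty
  simp only [stack, levelRise_eq_sub fun b => ha b (Finset.mem_univ b)]
  ring

theorem stack_nonneg (g : ∀ i, Fin (m i + 1) → ℤ) (i : Fin r) (a : Fin (m i + 1)) :
    0 ≤ stack g i a :=
  add_nonneg (levelRise_nonneg g i a) (Finset.sum_nonneg fun j _ => levelOsc_nonneg g j)

theorem stack_le_sum_Ici (g : ∀ i, Fin (m i + 1) → ℤ) (i : Fin r) (a : Fin (m i + 1)) :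
    stack g i a ≤ ∑ j ∈ Finset.Ici i, levelOsc g j := by
  have : Finset.Ici i = insert i (Finset.Ioi i) := by simp
  rw [this, Finset.sum_insert (by simp), stack]
  exact add_le_add_left (levelRise_le_levelOsc g i a) _

theorem stack_le_sum (g : ∀ i, Fin (m i + 1) → ℤ) (i : Fin r) (a : Fin (m i + 1)) :
    stack g i a ≤ ∑ j, levelOsc g j :=
  (stack_le_sum_Ici g i a).trans (Finset.sum_le_sum_of_subset_of_nonneg (Finset.subset_univ _)
    fun j _ _ => levelOsc_nonneg g j)

/-- Level `j` stays below the sum of the oscillations from `j` on, which is part of the sum on which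
level `i` rests. -/
theorem stack_le_stack (g : ∀ i, Fin (m i + 1) → ℤ) {i j : Fin r} (hij : i < j)
    (a : Fin (m i + 1)) (b : Fin (m j + 1)) : stack g j b ≤ stack g i a := by
  refine (stack_le_sum_Ici g j b).trans ?_
  refine (Finset.sum_le_sum_of_subset_of_nonneg (fun l hl => ?_)
    fun j _ _ => levelOsc_nonneg g j).trans (le_add_of_nonneg_left (levelRise_nonneg g i a))
  exact Finset.mem_Ioi.2 (hij.trans_le (Finset.mem_Ici.1 hl))

theorem Ioi_eq_insert {i j : Fin r} (hij : i.val + 1 = j.val) :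
    Finset.Ioi i = insert j (Finset.Ioi j) := by
  ext l
  simp only [Finset.mem_Ioi, Finset.mem_insert, Fin.lt_def, Fin.ext_iff]
  omega

theorem exists_stack_eq_sum_Ioi (g : ∀ i, Fin (m i + 1) → ℤ) (i : Fin r) :
    ∃ a, stack g i a = ∑ j ∈ Finset.Ioi i, levelOsc g j := by
  obtain ⟨a, ha⟩ := exists_levelRise_eq_zero g i
  exact ⟨a, by rw [stack, ha, zero_add]⟩

/-- The minimum of one level and the maximum of the next are both the sum of the oscillations beyond
`i`. -/
theorem exists_stack_eq_stack (g : ∀ i, Fin (m i + 1) → ℤ) {i j : Fin r}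
    (hij : i.val + 1 = j.val) : ∃ a b, stack g i a = stack g j b := by
  obtain ⟨a, ha⟩ := exists_stack_eq_sum_Ioi g i
  obtain ⟨b, hb⟩ := exists_levelRise_eq_levelOsc g j
  refine ⟨a, b, ?_⟩
  rw [ha, stack, hb, Ioi_eq_insert hij, Finset.sum_insert (by simp)]

/-- A stacked function is equatorial. -/
theorem isEquatorial_stack (hr : 1 ≤ r) (g : ∀ i, Fin (m i + 1) → ℤ) :
    IsEquatorial fun x : CompleteGradedPoset (fun i => m i + 1) =>
      ((stack g x.1 x.2).toNat : ℝ) := by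
  have hcast : ∀ i a, (((stack g i a).toNat : ℕ) : ℝ) = ((stack g i a : ℤ) : ℝ) := fun i a => by
    exact_mod_cast congrArg (Int.cast : ℤ → ℝ) (Int.toNat_of_nonneg (stack_nonneg g i a))
  refine CompleteGradedPoset.isEquatorial_iff.2 ⟨fun x => Nat.cast_nonneg _,
    fun i j hij a b => ?_, ?_, fun i j hij => ?_⟩
  · simp only [hcast]
    exact_mod_cast stack_le_stack g hij a b
  · obtain ⟨a, ha⟩ := exists_stack_eq_sum_Ioi g ⟨r - 1, by omega⟩
    have : Finset.Ioi (⟨r - 1, by omega⟩ : Fin r) = ∅ := by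
      ext l
      have := l.isLt
      simp only [Finset.mem_Ioi, Fin.lt_def, Finset.notMem_empty, iff_false]
      omega
    rw [this, Finset.sum_empty] at ha
    exact ⟨⟨_, a⟩, by simp [ha]⟩
  · obtain ⟨a, b, h⟩ := exists_stack_eq_stack g hij
    exact ⟨a, b, by simp only [h]⟩

/-- An equatorial function is the stack of its levels. -/
theorem stack_eq_self {f : CompleteGradedPoset (fun i => m i + 1) → ℕ}
    (hf : IsEquatorial fun x => (f x : ℝ)) (i : Fin r) (a : Fin (m i + 1)) :
    stack (fun i a => (f ⟨i, a⟩ : ℤ)) i a = f ⟨i, a⟩ := by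
  obtain ⟨-, h1, ⟨x, hx⟩, h3⟩ := CompleteGradedPoset.isEquatorial_iff.1 hf
  simp only [Nat.cast_le, Nat.cast_inj, Nat.cast_eq_zero] at h1 hx h3
  -- Induction starts at the level of highest rank, where the minimum is `0`; `k` counts the levels
  -- above `i`.
  have key : ∀ k : ℕ, ∀ i : Fin r, i.val + k + 1 = r → ∀ a,
      stack (fun i a => (f ⟨i, a⟩ : ℤ)) i a = f ⟨i, a⟩ := by
    intro k
    induction k with
    | zero =>
      intro i hi a
      obtain ⟨a₀, ha₀⟩ : ∃ a₀, f ⟨i, a₀⟩ = 0 := by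
        obtain ⟨l, c⟩ := x
        rcases lt_or_ge l i with h | h
        · exact ⟨0, Nat.le_zero.1 ((h1 l i h c 0).trans hx.le)⟩
        · have : l = i := by
            rw [Fin.le_def] at h
            ext
            omega
          subst this
          exact ⟨c, hx⟩
      have hI : Finset.Ioi i = ∅ := by
        ext l
        have := l.isLt
        simp only [Finset.mem_Ioi, Fin.lt_def, Finset.notMem_empty, iff_false]
        omega
      rw [stack, hI, Finset.sum_empty, levelRise_eq_sub (a₀ := a₀)]
      · simp [ha₀]
      · simp [ha₀]
    | succ k ih =>
      intro i hi a
      have hj : i.val + 1 < r := by omega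
      have hs := ih ⟨i.val + 1, hj⟩ (by simp only; omega)
      obtain ⟨a₀, b₀, h0⟩ := h3 i ⟨i.val + 1, hj⟩ rfl
      obtain ⟨b, hb⟩ := exists_levelRise_eq_levelOsc
        (fun i a => (f ⟨i, a⟩ : ℤ)) ⟨i.val + 1, hj⟩
      -- By induction the sum is the maximum of the next level, attained at `b`. The touching pair
      -- `a₀`, `b₀` then forces that maximum to equal the minimum of level `i`, attained at `a₀`.
      have hsum : ∑ j ∈ Finset.Ioi i, levelOsc (fun i a => (f ⟨i, a⟩ : ℤ)) j =
          f ⟨⟨i.val + 1, hj⟩, b⟩ := by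
        rw [Ioi_eq_insert (j := ⟨i.val + 1, hj⟩) rfl, Finset.sum_insert (by simp), ← hs b,
          stack, hb]
      have hlt : i < ⟨i.val + 1, hj⟩ := Fin.lt_def.2 (Nat.lt_succ_self _)
      have hbb : f ⟨⟨i.val + 1, hj⟩, b₀⟩ ≤ f ⟨⟨i.val + 1, hj⟩, b⟩ := by
        have h4 := hs b
        have h5 := hs b₀
        have h6 := levelRise_le_levelOsc (fun i a => (f ⟨i, a⟩ : ℤ)) ⟨i.val + 1, hj⟩ b₀
        rw [stack] at h4 h5
        omega
      have hmin : ∀ c, f ⟨i, a₀⟩ ≤ f ⟨i, c⟩ := fun c =>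
        (h0.le.trans hbb).trans (h1 _ _ hlt c b)
      have := h1 _ _ hlt a₀ b
      rw [stack, hsum, levelRise_eq_sub (a₀ := a₀) fun c => by simpa using hmin c]
      simp only
      omega
  exact key (r - 1 - i.val) i (by have := i.isLt; omega) a

/-- The total oscillation is itself a value of `f`, namely the maximum on the level of rank `1`. -/
theorem sum_levelOsc_le (hr : 1 ≤ r) {f : CompleteGradedPoset (fun i => m i + 1) → ℕ}
    (hf : IsEquatorial fun x => (f x : ℝ)) {k : ℕ} (hk : ∀ x, f x ≤ k) :
    ∑ i, levelOsc (fun i a => (f ⟨i, a⟩ : ℤ)) i ≤ k := by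
  obtain ⟨a, ha⟩ := exists_levelRise_eq_levelOsc (fun i a => (f ⟨i, a⟩ : ℤ)) ⟨0, hr⟩
  have hu : (Finset.univ : Finset (Fin r)) = insert ⟨0, hr⟩ (Finset.Ioi ⟨0, hr⟩) := by
    ext l
    simp only [Finset.mem_univ, Finset.mem_insert, Finset.mem_Ioi, Fin.lt_def, Fin.ext_iff,
      true_iff]
    omega
  rw [hu, Finset.sum_insert (by simp), ← ha]
  have := stack_eq_self hf ⟨0, hr⟩ a
  rw [stack] at this
  rw [this]
  exact_mod_cast hk _

end Levels

/-! ### Partial sums -/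

section PartialSum

variable {R : Type*} [AddCommGroup R] {m : ℕ}

/-- The partial sums `0, x 0, x 0 + x 1, …`. -/
def partialSum (x : Fin m → R) (a : Fin (m + 1)) : R :=
  ∑ l, if l.castSucc < a then x l else 0

theorem partialSum_succ_sub (x : Fin m → R) (l : Fin m) :
    partialSum x l.succ - partialSum x l.castSucc = x l := by
  rw [partialSum, partialSum, ← Finset.sum_sub_distrib, Finset.sum_eq_single l]
  · simp
  · intro b _ hb
    rw [Ne, Fin.ext_iff] at hb
    simp only [Fin.lt_def, Fin.val_castSucc, Fin.val_succ]
    have : (b.val < l.val + 1) ↔ (b.val < l.val) := by omega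
    simp [this]
  · simp

theorem sum_Icc_eq_partialSum_sub (x : Fin m → R) {i j : Fin m} (hij : i ≤ j) :
    ∑ l ∈ Finset.Icc i j, x l = partialSum x j.succ - partialSum x i.castSucc := by
  rw [partialSum, partialSum, ← Finset.sum_sub_distrib]
  rw [← Finset.sum_subset (Finset.subset_univ (Finset.Icc i j))]
  · refine Finset.sum_congr rfl fun l hl => ?_
    rw [Finset.mem_Icc, Fin.le_def, Fin.le_def] at hl
    have h1 : l.castSucc < j.succ := by
      rw [Fin.lt_def, Fin.val_castSucc, Fin.val_succ]
      omega
    have h2 : ¬ l.castSucc < i.castSucc := by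
      rw [Fin.lt_def, Fin.val_castSucc, Fin.val_castSucc]
      omega
    simp [h1, h2]
  · intro l _ hl
    rw [Finset.mem_Icc, Fin.le_def, Fin.le_def] at hl
    rw [Fin.le_def] at hij
    have : l.castSucc < j.succ ↔ l.castSucc < i.castSucc := by
      rw [Fin.lt_def, Fin.lt_def, Fin.val_castSucc, Fin.val_castSucc, Fin.val_succ]
      omega
    simp [this]

/-- Partial summation inverts taking consecutive differences up to an additive constant, to which
oscillations are blind. -/
theorem partialSum_diff (g : Fin (m + 1) → R) (a b : Fin (m + 1)) :
    partialSum (fun l : Fin m => g l.succ - g l.castSucc) a -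
      partialSum (fun l : Fin m => g l.succ - g l.castSucc) b = g a - g b := by
  have key : ∀ a, partialSum (fun l : Fin m => g l.succ - g l.castSucc) a -
      partialSum (fun l : Fin m => g l.succ - g l.castSucc) 0 = g a - g 0 := by
    intro a
    induction a using Fin.induction with
    | zero => simp
    | succ l ih =>
      have := partialSum_succ_sub (fun l : Fin m => g l.succ - g l.castSucc) l
      rw [← sub_add_sub_cancel _ (partialSum _ l.castSucc), this, ih, sub_add_sub_cancel]
  rw [← sub_sub_sub_cancel_right _ _ (partialSum _ 0), key, key, sub_sub_sub_cancel_right]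

theorem partialSum_zero (a : Fin (m + 1)) : partialSum (fun _ : Fin m => (0 : R)) a = 0 := by
  simp [partialSum]

theorem partialSum_intCast (x : Fin m → ℤ) (a : Fin (m + 1)) :
    partialSum (fun l => (x l : ℝ)) a = (partialSum x a : ℤ) := by
  simp only [partialSum]
  push_cast
  rfl

theorem partialSum_const_mul (c : ℝ) (x : Fin m → ℝ) (a : Fin (m + 1)) :
    partialSum (fun l => c * x l) a = c * partialSum x a := by
  simp only [partialSum, Finset.mul_sum, mul_ite, mul_zero]

theorem partialSum_add (x y : Fin m → R) (a : Fin (m + 1)) :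
    partialSum (fun l => x l + y l) a = partialSum x a + partialSum y a := by
  simp only [partialSum, ← Finset.sum_add_distrib]
  refine Finset.sum_congr rfl fun l _ => ?_
  split_ifs <;> simp

theorem partialSum_sub_le_sum_abs (x : Fin m → ℝ) (a b : Fin (m + 1)) :
    partialSum x a - partialSum x b ≤ ∑ l, |x l| := by
  rw [partialSum, partialSum, ← Finset.sum_sub_distrib]
  refine Finset.sum_le_sum fun l _ => ?_
  have := le_abs_self (x l)
  have := neg_abs_le (x l)
  have := abs_nonneg (x l)
  split_ifs <;> linarith

end PartialSum

/-! ### Lattice points and equatorial functions -/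

/-- The integer points on which the levelwise oscillations of the partial sums add up to at most
`k` correspond to the equatorial functions bounded by `k`. -/
theorem bijOn_equatorial {r : ℕ} (hr : 1 ≤ r) (m : Fin r → ℕ) (k : ℕ) :
    Set.BijOn (fun (f : CompleteGradedPoset (fun i => m i + 1) → ℕ) (p : Σ i, Fin (m i)) =>
        (f ⟨p.1, p.2.succ⟩ : ℤ) - f ⟨p.1, p.2.castSucc⟩)
      {f | IsEquatorial (fun x => (f x : ℝ)) ∧ ∀ x, f x ≤ k}
      {v | ∑ i, levelOsc (fun i => partialSum fun l => v ⟨i, l⟩) i ≤ k} := by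
  refine ⟨?_, ?_, ?_⟩
  · rintro f ⟨hf, hk⟩
    refine le_trans (le_of_eq ?_) (sum_levelOsc_le hr hf hk)
    rw [levelOsc_congr]
    exact fun i => partialSum_diff fun a => (f ⟨i, a⟩ : ℤ)
  · rintro f ⟨hf, -⟩ f' ⟨hf', -⟩ h
    have e : stack (fun i a => (f ⟨i, a⟩ : ℤ)) = stack (fun i a => (f' ⟨i, a⟩ : ℤ)) := by
      refine stack_congr fun i a b => ?_
      simp only
      rw [← partialSum_diff (fun a => (f ⟨i, a⟩ : ℤ)), ← partialSum_diff fun a => (f' ⟨i, a⟩ : ℤ)]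
      have : ∀ l : Fin (m i), (f ⟨i, l.succ⟩ : ℤ) - f ⟨i, l.castSucc⟩ =
          f' ⟨i, l.succ⟩ - f' ⟨i, l.castSucc⟩ := fun l => congrFun h ⟨i, l⟩
      simp only [this]
    funext ⟨i, a⟩
    have := congrFun (congrFun e i) a
    rw [stack_eq_self hf, stack_eq_self hf'] at this
    exact_mod_cast this
  · intro v hv
    refine ⟨fun x => (stack (fun i => partialSum fun l => v ⟨i, l⟩) x.1 x.2).toNat,
      ⟨isEquatorial_stack hr _, fun x => ?_⟩, ?_⟩
    · have := (stack_le_sum (fun i => partialSum fun l => v ⟨i, l⟩) x.1 x.2).trans hv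
      exact Int.toNat_le.2 this
    · funext ⟨i, l⟩
      simp only [Int.toNat_of_nonneg (stack_nonneg _ _ _)]
      rw [stack_sub_stack, partialSum_succ_sub]

/-! ### Polar duals of convex hulls -/

theorem polarDual_convexHull {ι : Type*} [Fintype ι] (T : Set (ι → ℝ)) :
    polarDual (convexHull ℝ T) = polarDual T := by
  ext x
  refine ⟨fun h y hy => h y (subset_convexHull ℝ T hy), fun h => ?_⟩
  have hc : Convex ℝ {y : ι → ℝ | -1 ≤ ∑ i, x i * y i} :=
    convex_halfSpace_ge (f := fun y : ι → ℝ => ∑ i, x i * y i)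
      ⟨fun y z => by simp [mul_add, Finset.sum_add_distrib],
        fun c y => by simp [Finset.mul_sum, mul_left_comm]⟩ (-1)
  exact fun y hy => convexHull_min (fun y hy => h y hy) hc hy

theorem polarDual_insert_zero {ι : Type*} [Fintype ι] (T : Set (ι → ℝ)) :
    polarDual (insert 0 T) = polarDual T := by
  ext x
  refine ⟨fun h y hy => h y (Set.mem_insert_of_mem _ hy), fun h y hy => ?_⟩
  rcases hy with rfl | hy
  · simp
  · exact h y hy

/-- The bipolar theorem for a finite set. -/
theorem polarDual_polarDual_convexHull {ι : Type*} [Fintype ι] {T : Set (ι → ℝ)}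
    (hT : T.Finite) : polarDual (polarDual (convexHull ℝ T)) = convexHull ℝ (insert 0 T) := by
  classical
  have hins : polarDual (convexHull ℝ T) = polarDual (convexHull ℝ (insert 0 T)) := by
    rw [polarDual_convexHull, polarDual_convexHull, polarDual_insert_zero]
  rw [hins]
  have h0 : (0 : ι → ℝ) ∈ convexHull ℝ (insert 0 T) :=
    subset_convexHull ℝ _ (Set.mem_insert _ _)
  apply Set.Subset.antisymm
  · intro y hy
    by_contra hmem
    obtain ⟨f, u, hf, hu⟩ := geometric_hahn_banach_closed_point (convex_convexHull ℝ _)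
      ((hT.insert 0).isCompact_convexHull ℝ).isClosed hmem
    have hu0 : 0 < u := by simpa using hf 0 h0
    have hrep : ∀ z : ι → ℝ, f z = ∑ i, z i * f (Pi.single i 1) := fun z => by
      refine (f.toLinearMap.pi_apply_eq_sum_univ z).trans (Finset.sum_congr rfl fun i _ => ?_)
      rw [smul_eq_mul, ContinuousLinearMap.coe_coe]
      congr 2
      funext j
      simp [Pi.single_apply, eq_comm]
    -- The separating functional, rescaled by `-u⁻¹`, is at least `-1` on the hull but below `-1` at
    -- `y`. Positivity of `u` comes from the origin lying in the hull.
    have hx : (fun i => -u⁻¹ * f (Pi.single i 1)) ∈ polarDual (convexHull ℝ (insert 0 T)) := by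
      intro z hz
      have h1 : ∑ i, -u⁻¹ * f (Pi.single i 1) * z i = -(u⁻¹ * f z) := by
        rw [hrep, Finset.mul_sum, ← Finset.sum_neg_distrib]
        exact Finset.sum_congr rfl fun i _ => by ring
      rw [h1, neg_le_neg_iff, inv_mul_le_iff₀ hu0, mul_one]
      exact (hf z hz).le
    have h2 := hy _ hx
    have h3 : ∑ i, y i * (-u⁻¹ * f (Pi.single i 1)) = -(u⁻¹ * f y) := by
      rw [hrep, Finset.mul_sum, ← Finset.sum_neg_distrib]
      exact Finset.sum_congr rfl fun i _ => by ring
    rw [h3, neg_le_neg_iff, inv_mul_le_iff₀ hu0, mul_one] at h2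
    linarith
  · intro y hy x hx
    have := hx y hy
    simpa only [mul_comm] using this

/-- Pairing with a point of the `i`-th copy involves only the `i`-th block, so the constraints
separate into a product. -/
theorem polarDual_freeSum {ι : Type*} [Fintype ι] [DecidableEq ι] {κ : ι → Type*}
    [∀ i, Fintype (κ i)] (Q : ∀ i, Set (κ i → ℝ)) :
    polarDual (freeSum Q) = {x | ∀ i, (fun a => x ⟨i, a⟩) ∈ polarDual (Q i)} := by
  rw [freeSum, polarDual_convexHull]
  have hsum : ∀ (i : ι) (x y : (Σ i, κ i) → ℝ), (∀ j, j ≠ i → ∀ a : κ j, y ⟨j, a⟩ = 0) →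
      ∑ p, x p * y p = ∑ a, x ⟨i, a⟩ * y ⟨i, a⟩ := by
    intro i x y hy
    rw [Fintype.sum_sigma, Finset.sum_eq_single i]
    · intro j _ hj
      simp [hy j hj]
    · simp
  ext x
  constructor
  · intro h i y hy
    let Y : ∀ j, κ j → ℝ := Pi.single i y
    have hY : (fun p : Σ i, κ i => Y p.1 p.2) ∈ summandCopy i (Q i) := by
      refine ⟨fun j hj a => ?_, ?_⟩
      · simp [Y, Pi.single_eq_of_ne hj]
      · simpa [Y] using hy
    have := h _ (Set.mem_iUnion.2 ⟨i, hY⟩)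
    rw [hsum i _ _ hY.1] at this
    simpa [Y] using this
  · intro h y hy
    obtain ⟨i, hy0, hyi⟩ := Set.mem_iUnion.1 hy
    rw [hsum i _ _ hy0]
    exact h i _ hyi

/-! ### Integral polytopes -/

theorem isIntegralPolytope_of_finite {ι : Type*} {T : Set (ι → ℝ)} (hT : T.Finite)
    (h : ∀ x ∈ T, ∃ v : ι → ℤ, intVec v = x) : IsIntegralPolytope (convexHull ℝ T) := by
  have hinj : Function.Injective (intVec : (ι → ℤ) → ι → ℝ) := fun v w hvw => by
    funext i
    exact Int.cast_injective (congrFun hvw i)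
  have hfin : (intVec ⁻¹' T : Set (ι → ℤ)).Finite := hT.preimage hinj.injOn
  refine ⟨hfin.toFinset, ?_⟩
  rw [hfin.coe_toFinset, Set.image_preimage_eq_of_subset]
  exact fun x hx => h x hx

theorem isIntegralPolytope_freeSum {ι : Type*} [Finite ι] [DecidableEq ι] {κ : ι → Type*}
    {Q : ∀ i, Set (κ i → ℝ)} (hQ : ∀ i, IsIntegralPolytope (Q i)) :
    IsIntegralPolytope (freeSum Q) := by
  choose S hS using hQ
  let E : ∀ i, (κ i → ℝ) →ₗ[ℝ] ((Σ i, κ i) → ℝ) := fun i =>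
    (LinearEquiv.piCurry ℝ fun (i : ι) (_ : κ i) => ℝ).symm.toLinearMap ∘ₗ
      LinearMap.single ℝ (fun i => κ i → ℝ) i
  have hE : ∀ i z p, E i z p = (Pi.single i z : ∀ i, κ i → ℝ) p.1 p.2 := fun i z p => rfl
  have hcopy : ∀ i (A : Set (κ i → ℝ)), summandCopy i A = E i '' A := by
    intro i A
    ext x
    constructor
    · rintro ⟨h0, hx⟩
      refine ⟨_, hx, ?_⟩
      funext ⟨j, a⟩
      rw [hE]
      by_cases hj : j = i
      · subst hj
        simp
      · simp [Pi.single_eq_of_ne hj, h0 j hj]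
    · rintro ⟨z, hz, rfl⟩
      refine ⟨fun j hj a => ?_, ?_⟩
      · rw [hE]
        simp [Pi.single_eq_of_ne hj]
      · simpa [hE] using hz
  have hfree : freeSum Q = convexHull ℝ (⋃ i, E i '' (intVec '' (S i : Set (κ i → ℤ)))) := by
    rw [freeSum]
    apply Set.Subset.antisymm
    · refine convexHull_min (Set.iUnion_subset fun i => ?_) (convex_convexHull ℝ _)
      rw [hcopy, hS i, LinearMap.image_convexHull]
      exact convexHull_mono (Set.subset_iUnion (fun i => E i '' (intVec '' (S i : Set _))) i)
    · refine convexHull_mono (Set.iUnion_mono fun i => ?_)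
      rw [hcopy]
      refine Set.image_mono ?_
      conv_rhs => rw [hS i]
      exact subset_convexHull ℝ _
  rw [hfree]
  refine isIntegralPolytope_of_finite
    (Set.finite_iUnion fun i => ((S i).finite_toSet.image _).image _) fun x hx => ?_
  obtain ⟨i, hx⟩ := Set.mem_iUnion.1 hx
  obtain ⟨_, ⟨v, -, rfl⟩, rfl⟩ := hx
  refine ⟨fun p => (Pi.single i v : ∀ i, κ i → ℤ) p.1 p.2, ?_⟩
  funext ⟨j, a⟩
  rw [hE]
  by_cases hj : j = i
  · subst hj
    simp [intVec]
  · simp [intVec, Pi.single_eq_of_ne hj]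

theorem isIntegralPolytope_setOf_forall {ι : Type*} [Finite ι] {κ : ι → Type*}
    {Q : ∀ i, Set (κ i → ℝ)} (hQ : ∀ i, IsIntegralPolytope (Q i)) :
    IsIntegralPolytope {x : (Σ i, κ i) → ℝ | ∀ i, (fun a => x ⟨i, a⟩) ∈ Q i} := by
  cases nonempty_fintype ι
  choose S hS using hQ
  let e := (LinearEquiv.piCurry ℝ fun (i : ι) (_ : κ i) => ℝ).symm
  have h : {x : (Σ i, κ i) → ℝ | ∀ i, (fun a => x ⟨i, a⟩) ∈ Q i} =
      convexHull ℝ (e.toLinearMap ''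
        Set.univ.pi fun i => (intVec '' (S i : Set (κ i → ℤ)))) := by
    rw [← LinearMap.image_convexHull, convexHull_pi]
    ext x
    constructor
    · intro hx
      refine ⟨fun i a => x ⟨i, a⟩, fun i _ => ?_, ?_⟩
      · simpa only [← hS i] using hx i
      · rfl
    · rintro ⟨y, hy, rfl⟩ i
      rw [hS i]
      exact hy i (Set.mem_univ i)
  rw [h]
  refine isIntegralPolytope_of_finite
    ((Set.Finite.pi fun i => (S i).finite_toSet.image intVec).image _) fun x hx => ?_
  obtain ⟨y, hy, rfl⟩ := hx
  choose v _ hv using fun i => hy i (Set.mem_univ i)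
  refine ⟨fun p => v p.1 p.2, ?_⟩
  funext ⟨i, a⟩
  exact congrFun (hv i) a

/-! ### The duals of the root polytopes -/

/-- The vectors `± (e_i + ⋯ + e_j)`. -/
def rootVectors (m : ℕ) : Set (Fin m → ℝ) :=
  {v | ∃ i j : Fin m, i ≤ j ∧
    (v = ∑ k ∈ Finset.Icc i j, Pi.single k (1 : ℝ) ∨
      v = -∑ k ∈ Finset.Icc i j, Pi.single k (1 : ℝ))}

theorem rootPolytopeA_eq (m : ℕ) : rootPolytopeA m = convexHull ℝ (rootVectors m) := rfl

theorem finite_rootVectors (m : ℕ) : (rootVectors m).Finite := by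
  refine (Set.finite_range fun p : (Fin m × Fin m) × Bool =>
    if p.2 then ∑ k ∈ Finset.Icc p.1.1 p.1.2, Pi.single k (1 : ℝ)
    else -∑ k ∈ Finset.Icc p.1.1 p.1.2, Pi.single k (1 : ℝ)).subset ?_
  rintro v ⟨i, j, -, rfl | rfl⟩
  · exact ⟨((i, j), true), by simp⟩
  · exact ⟨((i, j), false), by simp⟩

theorem sum_mul_sum_single {m : ℕ} (x : Fin m → ℝ) (i j : Fin m) :
    ∑ l, x l * (∑ k ∈ Finset.Icc i j, Pi.single k (1 : ℝ) : Fin m → ℝ) l =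
      ∑ l ∈ Finset.Icc i j, x l := by
  simp only [Finset.sum_apply, Pi.single_apply, Finset.sum_ite_eq, mul_ite, mul_one, mul_zero]
  rw [← Finset.sum_filter]
  exact Finset.sum_congr (by ext; simp) fun _ _ => rfl

/-- The root vectors pair with `x` to give exactly the differences of its partial sums at distinct
indices. -/
theorem mem_polarDual_rootPolytopeA {m : ℕ} {x : Fin m → ℝ} :
    x ∈ polarDual (rootPolytopeA m) ↔ ∀ a b, partialSum x a - partialSum x b ≤ 1 := by
  rw [rootPolytopeA_eq, polarDual_convexHull]
  constructor
  · intro h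
    have key : ∀ i j : Fin m, i ≤ j →
        |partialSum x j.succ - partialSum x i.castSucc| ≤ 1 := by
      intro i j hij
      have h1 := h _ ⟨i, j, hij, Or.inl rfl⟩
      have h2 := h _ ⟨i, j, hij, Or.inr rfl⟩
      rw [sum_mul_sum_single, sum_Icc_eq_partialSum_sub x hij] at h1
      simp only [Pi.neg_apply, mul_neg, Finset.sum_neg_distrib] at h2
      rw [sum_mul_sum_single, sum_Icc_eq_partialSum_sub x hij] at h2
      exact abs_le.2 ⟨h1, by linarith⟩
    have key' : ∀ a b : Fin (m + 1), b < a → |partialSum x a - partialSum x b| ≤ 1 := by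
      intro a b hab
      rw [Fin.lt_def] at hab
      have ha := a.isLt
      have := key ⟨b, by omega⟩ ⟨a - 1, by omega⟩ (by rw [Fin.le_def]; simp only; omega)
      have hsucc : (⟨a - 1, by omega⟩ : Fin m).succ = a := by
        rw [Fin.ext_iff, Fin.val_succ]
        simp only
        omega
      rwa [hsucc] at this
    intro a b
    rcases lt_trichotomy a b with hab | rfl | hab
    · have := (abs_le.1 (key' b a hab)).1
      linarith
    · simp
    · exact (abs_le.1 (key' a b hab)).2
  · rintro h _ ⟨i, j, hij, rfl | rfl⟩
    · rw [sum_mul_sum_single, sum_Icc_eq_partialSum_sub x hij]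
      have := h i.castSucc j.succ
      linarith
    · simp only [Pi.neg_apply, mul_neg, Finset.sum_neg_distrib]
      rw [sum_mul_sum_single, sum_Icc_eq_partialSum_sub x hij]
      have := h j.succ i.castSucc
      linarith

/-- The polytope is the image of the cube `[0,1]^(m+1)` under consecutive differences: partial sums,
lowered by their minimum, lift `x` to the cube. Vertices of the cube map to integer vectors. -/
theorem isIntegralPolytope_polarDual_rootPolytopeA (m : ℕ) :
    IsIntegralPolytope (polarDual (rootPolytopeA m)) := by
  let D : (Fin (m + 1) → ℝ) →ₗ[ℝ] (Fin m → ℝ) :=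
    { toFun := fun g l => g l.succ - g l.castSucc
      map_add' := fun g g' => by
        funext l
        simp only [Pi.add_apply]
        ring
      map_smul' := fun c g => by
        funext l
        simp only [Pi.smul_apply, smul_eq_mul, RingHom.id_apply]
        ring }
  have h : polarDual (rootPolytopeA m) =
      convexHull ℝ (D '' Set.univ.pi fun _ => ({0, 1} : Set ℝ)) := by
    rw [← LinearMap.image_convexHull, convexHull_pi, convexHull_pair,
      segment_eq_Icc zero_le_one]
    ext x
    rw [mem_polarDual_rootPolytopeA]
    constructor
    · intro hx
      obtain ⟨a₀, -, ha₀⟩ := Finset.exists_min_image Finset.univ (partialSum x)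
        Finset.univ_nonempty
      refine ⟨fun a => partialSum x a - partialSum x a₀, fun a _ =>
        ⟨sub_nonneg.2 (ha₀ a (Finset.mem_univ a)), hx a a₀⟩, ?_⟩
      funext l
      change partialSum x l.succ - partialSum x a₀ - (partialSum x l.castSucc - partialSum x a₀) = _
      rw [sub_sub_sub_cancel_right, partialSum_succ_sub]
    · rintro ⟨g, hg, rfl⟩ a b
      have := partialSum_diff g a b
      have h1 := (hg a (Set.mem_univ a)).2
      have h2 := (hg b (Set.mem_univ b)).1
      change partialSum (fun l : Fin m => g l.succ - g l.castSucc) a -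
        partialSum (fun l : Fin m => g l.succ - g l.castSucc) b ≤ 1
      linarith
  rw [h]
  refine isIntegralPolytope_of_finite
    ((Set.Finite.pi fun _ => Set.toFinite ({0, 1} : Set ℝ)).image _) fun x hx => ?_
  obtain ⟨g, hg, rfl⟩ := hx
  have : ∀ a, ∃ v : ℤ, (v : ℝ) = g a := fun a => by
    rcases hg a (Set.mem_univ a) with h | h
    · exact ⟨0, by simp [h]⟩
    · exact ⟨1, by rw [Set.mem_singleton_iff.1 h, Int.cast_one]⟩
  choose v hv using this
  refine ⟨fun l => v l.succ - v l.castSucc, ?_⟩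
  funext l
  simp [intVec, D, hv]

theorem isIntegralPolytope_polarDual_polarDual_rootPolytopeA (m : ℕ) :
    IsIntegralPolytope (polarDual (polarDual (rootPolytopeA m))) := by
  rw [rootPolytopeA_eq, polarDual_polarDual_convexHull (finite_rootVectors m)]
  -- The adjoined origin matters for `m = 0`, where there are no root vectors.
  refine isIntegralPolytope_of_finite ((finite_rootVectors m).insert 0) ?_
  have hint : ∀ i j : Fin m, intVec (∑ k ∈ Finset.Icc i j, Pi.single k (1 : ℤ)) =
      ∑ k ∈ Finset.Icc i j, Pi.single k (1 : ℝ) := fun i j => by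
    funext l
    simp [intVec, Finset.sum_apply, Pi.single_apply]
  rintro x (rfl | ⟨i, j, -, rfl | rfl⟩)
  · exact ⟨0, by funext l; simp [intVec]⟩
  · exact ⟨_, hint i j⟩
  · refine ⟨-∑ k ∈ Finset.Icc i j, Pi.single k (1 : ℤ), ?_⟩
    rw [← hint]
    funext l
    simp [intVec]

/-! ### The free sum of the duals of the root polytopes -/

section FreeSum

variable {r : ℕ} {m : Fin r → ℕ}

/-- The `t i` are the weights of a convex combination: the `i`-th block of `x` is `t i` times a
point of the `i`-th summand. -/
theorem mem_freeSum_iff (hr : 1 ≤ r) {x : (Σ i, Fin (m i)) → ℝ} :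
    x ∈ freeSum (fun i => polarDual (rootPolytopeA (m i))) ↔
      ∃ t : Fin r → ℝ, ∑ i, t i ≤ 1 ∧
        ∀ i a b, partialSum (fun l => x ⟨i, l⟩) a - partialSum (fun l => x ⟨i, l⟩) b ≤ t i := by
  constructor
  · intro hx
    refine convexHull_min (t := {x : (Σ i, Fin (m i)) → ℝ | ∃ t : Fin r → ℝ, ∑ i, t i ≤ 1 ∧
      ∀ i a b, partialSum (fun l => x ⟨i, l⟩) a - partialSum (fun l => x ⟨i, l⟩) b ≤ t i})
      (Set.iUnion_subset fun i => ?_) ?_ hx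
    · rintro y ⟨h0, hy⟩
      refine ⟨Pi.single i 1, by simp, fun j a b => ?_⟩
      by_cases hj : j = i
      · subst hj
        simpa using mem_polarDual_rootPolytopeA.1 hy a b
      · simp [h0 j hj, partialSum_zero, Pi.single_eq_of_ne hj]
    · rintro y ⟨t, ht, hy⟩ z ⟨u, hu, hz⟩ α β hα hβ hαβ
      refine ⟨fun i => α * t i + β * u i, ?_, fun i a b => ?_⟩
      · rw [Finset.sum_add_distrib, ← Finset.mul_sum, ← Finset.mul_sum]
        nlinarith
      · simp only [Pi.add_apply, Pi.smul_apply, smul_eq_mul, partialSum_add,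
          partialSum_const_mul]
        have := mul_le_mul_of_nonneg_left (hy i a b) hα
        have := mul_le_mul_of_nonneg_left (hz i a b) hβ
        linarith
  · rintro ⟨t, ht, hx⟩
    -- The slack goes to block `0`, which exists because `r ≥ 1`, so that the weights sum to exactly
    -- `1`.
    obtain ⟨t, ht, hx⟩ : ∃ t : Fin r → ℝ, ∑ i, t i = 1 ∧
        ∀ i a b, partialSum (fun l => x ⟨i, l⟩) a - partialSum (fun l => x ⟨i, l⟩) b ≤ t i := by
      refine ⟨fun i => t i + (Pi.single ⟨0, hr⟩ (1 - ∑ i, t i) : Fin r → ℝ) i, ?_,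
        fun i a b => (hx i a b).trans (le_add_of_nonneg_right ?_)⟩
      · rw [Finset.sum_add_distrib, Finset.sum_pi_single']
        simp
      · have h : (0 : Fin r → ℝ) ≤ Pi.single ⟨0, hr⟩ (1 - ∑ i, t i) :=
          Pi.single_nonneg.2 (sub_nonneg.2 ht)
        exact h i
    have ht0 : ∀ i, 0 ≤ t i := fun i => by simpa using hx i 0 0
    have hzero : ∀ i, t i = 0 → ∀ l, x ⟨i, l⟩ = 0 := by
      intro i hi l
      have h1 := hx i l.succ l.castSucc
      have h2 := hx i l.castSucc l.succ
      have h3 := partialSum_succ_sub (fun l => x ⟨i, l⟩) l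
      linarith
    -- If `t i = 0` then `(t i)⁻¹ = 0`, so `z i` is the origin; by `hzero` that block of `x`
    -- vanishes as well.
    let z : Fin r → (Σ i, Fin (m i)) → ℝ := fun i p => if p.1 = i then (t i)⁻¹ * x p else 0
    have hz : ∀ i, z i ∈ freeSum (fun i => polarDual (rootPolytopeA (m i))) := by
      intro i
      refine subset_convexHull ℝ _ (Set.mem_iUnion.2 ⟨i, fun j hj a => by simp [z, hj], ?_⟩)
      rw [mem_polarDual_rootPolytopeA]
      intro a b
      simp only [z, if_true, partialSum_const_mul]
      rw [← mul_sub]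
      rcases (ht0 i).eq_or_lt with h | h
      · simp [← h]
      · rw [inv_mul_le_iff₀ h, mul_one]
        exact hx i a b
    have hxz : x = ∑ i, t i • z i := by
      funext p
      rw [Finset.sum_apply, Finset.sum_eq_single p.1]
      · simp only [Pi.smul_apply, smul_eq_mul, z, if_true]
        rcases (ht0 p.1).eq_or_lt with h | h
        · rw [hzero p.1 h.symm p.2, mul_zero, mul_zero]
        · rw [mul_inv_cancel_left₀ h.ne']
      · intro i _ hi
        simp [z, hi.symm]
      · simp
    rw [hxz]
    exact (convex_convexHull ℝ _).sum_mem (fun i _ => ht0 i) ht fun i _ => hz i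

theorem mem_latticePoints_freeSum_iff (hr : 1 ≤ r) {k : ℕ} (hk : 1 ≤ k)
    {v : (Σ i, Fin (m i)) → ℤ} :
    v ∈ latticePoints (freeSum fun i => polarDual (rootPolytopeA (m i))) k ↔
      ∑ i, levelOsc (fun i => partialSum fun l => v ⟨i, l⟩) i ≤ k := by
  have hk0 : (0 : ℝ) < k := by exact_mod_cast hk
  change intVec v ∈ (k : ℝ) • freeSum (fun i => polarDual (rootPolytopeA (m i))) ↔ _
  rw [Set.mem_smul_set_iff_inv_smul_mem₀ hk0.ne', mem_freeSum_iff hr]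
  simp only [Pi.smul_apply, smul_eq_mul, intVec, partialSum_const_mul, partialSum_intCast,
    ← mul_sub]
  constructor
  · rintro ⟨t, ht, h⟩
    have h1 : ∀ i, (levelOsc (fun i => partialSum fun l => v ⟨i, l⟩) i : ℝ) ≤ k * t i := by
      intro i
      obtain ⟨a, b, hab⟩ := exists_sub_eq_levelOsc (fun i => partialSum fun l => v ⟨i, l⟩) i
      rw [← hab, ← inv_mul_le_iff₀ hk0]
      push_cast
      exact h i a b
    have h2 := Finset.sum_le_sum fun i (_ : i ∈ Finset.univ) => h1 i
    rw [← Finset.mul_sum] at h2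
    have h3 := h2.trans (mul_le_of_le_one_right hk0.le ht)
    exact_mod_cast h3
  · intro h
    refine ⟨fun i => (k : ℝ)⁻¹ * levelOsc (fun i => partialSum fun l => v ⟨i, l⟩) i, ?_,
      fun i a b => ?_⟩
    · rw [← Finset.mul_sum, inv_mul_le_iff₀ hk0, mul_one]
      exact_mod_cast h
    · refine mul_le_mul_of_nonneg_left ?_ (inv_nonneg.2 hk0.le)
      exact_mod_cast sub_le_levelOsc (fun i => partialSum fun l => v ⟨i, l⟩) i a b

theorem zero_mem_interior_freeSum (hr : 1 ≤ r) :
    (0 : (Σ i, Fin (m i)) → ℝ) ∈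
      interior (freeSum fun i => polarDual (rootPolytopeA (m i))) := by
  have hc : Continuous fun x : (Σ i, Fin (m i)) → ℝ => ∑ i, ∑ l, |x ⟨i, l⟩| := by fun_prop
  -- The open `ℓ¹` ball works, since the `ℓ¹` norm of a block bounds the oscillation of its partial
  -- sums.
  refine mem_interior.2 ⟨{x | ∑ i, ∑ l, |x ⟨i, l⟩| < 1}, fun x hx => ?_,
    isOpen_lt hc continuous_const, by simp⟩
  exact (mem_freeSum_iff hr).2 ⟨fun i => ∑ l, |x ⟨i, l⟩|, hx.le,
    fun i a b => partialSum_sub_le_sum_abs _ a b⟩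

theorem isReflexive_freeSum (hr : 1 ≤ r) :
    IsReflexive (freeSum fun i => polarDual (rootPolytopeA (m i))) := by
  refine ⟨isIntegralPolytope_freeSum fun i =>
    isIntegralPolytope_polarDual_rootPolytopeA (m i), zero_mem_interior_freeSum hr, ?_⟩
  rw [polarDual_freeSum]
  exact isIntegralPolytope_setOf_forall fun i =>
    isIntegralPolytope_polarDual_polarDual_rootPolytopeA (m i)

theorem isEhrhartPolynomial_freeSum (hr : 1 ≤ r) :
    IsEhrhartPolynomial (freeSum fun i => polarDual (rootPolytopeA (m i)))
      (equatorialEhrhartPolynomial (CompleteGradedPoset fun i => m i + 1)) := by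
  intro k hk
  have hset : latticePoints (freeSum fun i => polarDual (rootPolytopeA (m i))) k =
      {v | ∑ i, levelOsc (fun i => partialSum fun l => v ⟨i, l⟩) i ≤ k} :=
    Set.ext fun v => mem_latticePoints_freeSum_iff hr hk
  have hbij := bijOn_equatorial hr m k
  rw [hset, ← hbij.image_eq, hbij.injOn.ncard_image,
    equatorialEhrhartPolynomial_eval (CompleteGradedPoset.isEquatorial_zero hr)]
  exact ⟨((Set.Finite.pi' fun _ => Set.finite_Iic k).subset fun f hf => hf.2).image _, rfl⟩

end FreeSum

theorem IsEhrhartPolynomial.unique {ι : Type*} {Q : Set (ι → ℝ)} {p q : ℚ[X]}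
    (hp : IsEhrhartPolynomial Q p) (hq : IsEhrhartPolynomial Q q) : p = q := by
  apply eq_of_infinite_eval_eq
  refine ((Set.Ici_infinite 1).image (Nat.cast_injective (R := ℚ)).injOn).mono ?_
  rintro _ ⟨k, hk, rfl⟩
  exact (hp k hk).2.trans (hq k hk).2.symm

theorem IsEhrhartPolynomial.eq_ehrhartPolynomial {ι : Type*} {Q : Set (ι → ℝ)} {p : ℚ[X]}
    (hp : IsEhrhartPolynomial Q p) : p = ehrhartPolynomial Q := by
  have h : ∃ p : ℚ[X], IsEhrhartPolynomial Q p := ⟨p, hp⟩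
  rw [ehrhartPolynomial, dif_pos h]
  exact hp.unique h.choose_spec

theorem mainTheorem7 (r : ℕ) (hr : 1 ≤ r) (n : Fin r → ℕ) (hn : ∀ i, 1 ≤ n i) :
    IsEhrhartPolynomial (freeSum fun i => polarDual (rootPolytopeA (n i - 1)))
        (equatorialEhrhartPolynomial (CompleteGradedPoset n)) ∧
      equatorialEhrhartPolynomial (CompleteGradedPoset n) =
        ehrhartPolynomial (freeSum fun i => polarDual (rootPolytopeA (n i - 1))) ∧
      (IsCLPolynomial (equatorialEhrhartPolynomial (CompleteGradedPoset n)) ↔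
        IsCLPolytope (freeSum fun i => polarDual (rootPolytopeA (n i - 1)))) := by
  -- Writing the sizes as successors makes nonemptiness of the levels definitional, and `m i + 1 -
  -- 1` reduces to `m i`.
  obtain ⟨m, rfl⟩ : ∃ m : Fin r → ℕ, n = fun i => m i + 1 :=
    ⟨fun i => n i - 1, funext fun i => (Nat.sub_add_cancel (hn i)).symm⟩
  have h1 : IsEhrhartPolynomial (freeSum fun i => polarDual (rootPolytopeA (m i + 1 - 1)))
      (equatorialEhrhartPolynomial (CompleteGradedPoset fun i => m i + 1)) :=
    isEhrhartPolynomial_freeSum hr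
  have h2 := h1.eq_ehrhartPolynomial
  have h3 : IsReflexive (freeSum fun i => polarDual (rootPolytopeA (m i + 1 - 1))) :=
    isReflexive_freeSum hr
  exact ⟨h1, h2, fun h => ⟨h3, h2 ▸ h⟩, fun h => h2 ▸ h.2⟩
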